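/- Let $S^+(p,n)$ be the set of real symmetric positive semidefinite $n\times n$ matrices of rank $p$, and let $\mathrm{span}(B)$ denote the column space of a matrix $B$. For $R\in SO(n)$ let the magnitude $|R|$ be its geodesic distance to the identity in $SO(n)$, i.e. the infimum of the Frobenius norms $\|\Omega\|_F$ over skew-symmetric $\Omega$ with $\exp\Omega=R$. A rotation acts on $S^+(p,n)$ by $A\mapsto RAR^T$. For positive definite $X,Y$ put $X\# Y=X^{1/2}(X^{-1/2}YX^{-1/2})^{1/2}X^{1/2}$. The Ando mean of two positive semidefinite matrices $A,B$ is the limit of $X_k\# Y_k$ for all sequences of positive definite matrices $X_k,Y_k$ decreasing (in the Loewner order) to $A$ and $B$. For $A_1,A_2\in S^+(p,n)$ whose column spaces have principal angles all smaller than $\pi/2$, the rank-preserving mean $A_1\circ A_2$ is defined as follows. Let the columns of $U_i\in\mathbb R^{n\times p}$ be an orthonormal basis of $\mathrm{span}(A_i)$, let $U_1^TU_2=O_1(\cos\Sigma)O_2^T$ be a singular value decomposition, with $O_1,O_2\in O(p)$ and $\Sigma$ the diagonal matrix of the principal angles, which lie in $[0,\pi/2)$, and let $Y_i=U_iO_i$.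 Let $W=Y_1\cos\frac{\Sigma}{2}+X\sin\frac{\Sigma}{2}$ with $X=(Y_2-Y_1\cos\Sigma)(\sin\Sigma)^{\dagger}$ be the midpoint of the Grassmann geodesic from $Y_1$ to $Y_2$. Then $A_1\circ A_2=W\big((Y_1^TA_1Y_1)\#(Y_2^TA_2Y_2)\big)W^T$. Let $A\in S^+(p,n)$. (1) If $R\in SO(n)$ and $\mathrm{span}(RAR^T)\cap\mathrm{span}(A)=\{0\}$, then the Ando mean of $A$ and $RAR^T$ is the zero matrix. (2) If $0<p<n/2$, then for every $\delta>0$ there is $R\in SO(n)$ with $0<|R|<\delta$ and $\mathrm{span}(RAR^T)\cap\mathrm{span}(A)=\{0\}$. (3) $A\circ RAR^T\to A$ as $|R|\to 0$: for every neighbourhood $V$ of $A$ there is $\delta>0$ such that for every $R\in SO(n)$ with $|R|<\delta$ the mean $A\circ RAR^T$ is defined (the construction above can be carried out), and every admissible choice of $U_1,U_2,O_1,O_2,\Sigma$ gives a value in $V$. -/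

import Mathlib

open scoped Matrix MatrixOrder Topology ENNReal
open Filter

noncomputable section

/-- `S⁺(p,n)`: the real symmetric positive semidefinite `n × n` matrices of rank `p`. -/
def SPlus (p n : ℕ) : Set (Matrix (Fin n) (Fin n) ℝ) :=
  {A | A.PosSemidef ∧ A.rank = p}

/-- The subspace of `ℝⁿ` spanned by the columns of a matrix. -/
def colSpan {n m : ℕ} (A : Matrix (Fin n) (Fin m) ℝ) : Submodule ℝ (Fin n → ℝ) :=
  Submodule.span ℝ (Set.range Aᵀ)

/-- The magnitude of a rotation `R`: its geodesic distance to the identity in `SO(n)` with the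
metric `⟨Ω₁, Ω₂⟩ = tr (Ω₁ᵀ Ω₂)`. Geodesics issued from the identity are `t ↦ exp (t Ω)` with
`Ω` skew-symmetric, so it is the least Frobenius norm of a skew-symmetric logarithm of `R`. -/
def rotationMagnitude {n : ℕ} (R : Matrix (Fin n) (Fin n) ℝ) : ℝ≥0∞ :=
  ⨅ (Ω : Matrix (Fin n) (Fin n) ℝ) (_ : Ωᵀ = -Ω ∧ NormedSpace.exp Ω = R),
    ENNReal.ofReal (Real.sqrt (Ωᵀ * Ω).trace)

/-- Ando's geometric mean `A # B = A^{1/2} (A^{-1/2} B A^{-1/2})^{1/2} A^{1/2}` of two positive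
definite matrices. -/
def geomMean {m : ℕ} (A B : Matrix (Fin m) (Fin m) ℝ) : Matrix (Fin m) (Fin m) ℝ :=
  CFC.sqrt A * CFC.sqrt ((CFC.sqrt A)⁻¹ * B * (CFC.sqrt A)⁻¹) * CFC.sqrt A

/-- A sequence of positive definite matrices that decreases (in the Loewner order) to `A`. -/
def DecreasesTo {n : ℕ} (X : ℕ → Matrix (Fin n) (Fin n) ℝ)
    (A : Matrix (Fin n) (Fin n) ℝ) : Prop :=
  (∀ k, (X k).PosDef) ∧ Antitone X ∧ Tendsto X atTop (𝓝 A)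

/-- `M` is the Ando mean of the positive semidefinite matrices `A` and `B`: the extension of `#`
to the boundary of the cone by continuity from above. -/
def IsAndoMean {n : ℕ} (A B M : Matrix (Fin n) (Fin n) ℝ) : Prop :=
  A.PosSemidef ∧ B.PosSemidef ∧
    ∀ X Y : ℕ → Matrix (Fin n) (Fin n) ℝ, DecreasesTo X A → DecreasesTo Y B →
      Tendsto (fun k => geomMean (X k) (Y k)) atTop (𝓝 M)

/-- The columns of the `n × p` matrix `U` form an orthonormal basis of the column space
of `A`. -/
def IsOrthonormalBasisOfSpan {p n : ℕ} (U : Matrix (Fin n) (Fin p) ℝ)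
    (A : Matrix (Fin n) (Fin n) ℝ) : Prop :=
  Uᵀ * U = 1 ∧ colSpan U = colSpan A

/-- The midpoint `W = Y₁ cos(Σ/2) + X sin(Σ/2)` of the Grassmann geodesic
`t ↦ Y₁ cos(tΣ) + X sin(tΣ)` from `Y₁` to `Y₂`, where `Σ = diag θ` and
`X = (Y₂ - Y₁ cos Σ) (sin Σ)^†` (the inverse in `ℝ` has `0⁻¹ = 0`, so the diagonal matrix with
entries `(sin θ i)⁻¹` is the pseudo-inverse of `sin Σ`; a column of `X` with `θ i = 0` is
multiplied by `sin 0 = 0`, so its value does not matter). -/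
def grassmannMidpoint {p n : ℕ} (Y₁ Y₂ : Matrix (Fin n) (Fin p) ℝ) (θ : Fin p → ℝ) :
    Matrix (Fin n) (Fin p) ℝ :=
  Y₁ * Matrix.diagonal (fun i => Real.cos (θ i / 2)) +
    ((Y₂ - Y₁ * Matrix.diagonal (fun i => Real.cos (θ i))) *
      Matrix.diagonal (fun i => (Real.sin (θ i))⁻¹)) *
      Matrix.diagonal (fun i => Real.sin (θ i / 2))

/-- `M` is a value of the rank-preserving mean `A₁ ∘ A₂` of `A₁, A₂ ∈ S⁺(p,n)`, obtained from some
orthonormal bases `U₁, U₂` of the two column spaces and some singular value decomposition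
`U₁ᵀ U₂ = O₁ (cos Σ) O₂ᵀ` with all principal angles (the diagonal entries `θ i` of `Σ`) smaller
than `π/2`. With `Yᵢ = Uᵢ Oᵢ`, `W` the Riemannian mean of `Y₁` and `Y₂`, and `Rᵢ² = Yᵢᵀ Aᵢ Yᵢ`,
one has `M = W (R₁² # R₂²) Wᵀ`. -/
def IsRankPreservingMean {n : ℕ} (p : ℕ) (A₁ A₂ M : Matrix (Fin n) (Fin n) ℝ) : Prop :=
  A₁ ∈ SPlus p n ∧ A₂ ∈ SPlus p n ∧
    ∃ (U₁ U₂ : Matrix (Fin n) (Fin p) ℝ) (O₁ O₂ : Matrix (Fin p) (Fin p) ℝ) (θ : Fin p → ℝ),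
      IsOrthonormalBasisOfSpan U₁ A₁ ∧ IsOrthonormalBasisOfSpan U₂ A₂ ∧
      O₁ ∈ Matrix.orthogonalGroup (Fin p) ℝ ∧ O₂ ∈ Matrix.orthogonalGroup (Fin p) ℝ ∧
      (∀ i, 0 ≤ θ i ∧ θ i < Real.pi / 2) ∧
      U₁ᵀ * U₂ = O₁ * Matrix.diagonal (fun i => Real.cos (θ i)) * O₂ᵀ ∧
      M = grassmannMidpoint (U₁ * O₁) (U₂ * O₂) θ *
        geomMean ((U₁ * O₁)ᵀ * A₁ * (U₁ * O₁)) ((U₂ * O₂)ᵀ * A₂ * (U₂ * O₂)) *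
        (grassmannMidpoint (U₁ * O₁) (U₂ * O₂) θ)ᵀ

end

/-!
For positive definite `X`, `Y` the mean `X # Y` is of the form `Sᵀ T` with `Sᵀ S = X`, `Tᵀ T = Y`,
so Cauchy-Schwarz gives `⟨x, (X # Y) y⟩² ≤ ⟨x, X x⟩ ⟨y, Y y⟩`. If `X ↓ A` and `Y ↓ B`, the
right-hand side tends to `0` as soon as `A x = 0` or `B y = 0`, and when the column spaces of `A`
and `B` meet trivially, `ker A` and `ker B` span the whole space; hence `X # Y → 0`.

If `2 p ≤ n`, take orthonormal bases `U` of the column space of `A` and `V` of a `p`-dimensional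
space orthogonal to it. The rotation `exp (t (V Uᵀ - U Vᵀ))` sends `U` to `cos t U + sin t V`, whose
column space meets that of `U` trivially for every `t ∈ (0, π)`, and its magnitude is `O(t)`.

For the rank-preserving mean of `A` and `B`, write `Y₁`, `Y₂` for the principal bases and
`P = Y₁ᵀ A Y₁`. Since `(1 - Y₂ Y₂ᵀ) Y₁ P = (1 - Y₂ Y₂ᵀ) (A - B) Y₁`, the sines of the principal
angles are at most `‖P⁻¹‖ ‖B - A‖`, and this controls `Y₂ - Y₁`, the midpoint `W` and, together with
`‖P # Q - P‖ ≤ ‖P‖ ‖P⁻¹‖ ‖Q - P‖`, the whole mean. As `‖P⁻¹‖` does not depend on the orthonormal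
basis of the column space of `A`, the resulting bound is uniform over all admissible choices.
-/

open Matrix

section ColumnSpace

variable {n m q : ℕ}

theorem mulVec_dotProduct_mulVec {α ι κ μ : Type*} [CommSemiring α] [Fintype ι] [Fintype κ]
    [Fintype μ] (M : Matrix ι κ α) (N : Matrix ι μ α) (x : κ → α) (y : μ → α) :
    (M *ᵥ x) ⬝ᵥ (N *ᵥ y) = x ⬝ᵥ ((Mᵀ * N) *ᵥ y) := by
  rw [← mulVec_mulVec, dotProduct_mulVec x Mᵀ, vecMul_transpose]

theorem colSpan_eq_range (A : Matrix (Fin n) (Fin m) ℝ) :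
    colSpan A = LinearMap.range A.mulVecLin :=
  (range_mulVecLin A).symm

theorem mem_colSpan {A : Matrix (Fin n) (Fin m) ℝ} {x : Fin n → ℝ} :
    x ∈ colSpan A ↔ ∃ y, A *ᵥ y = x := by
  rw [colSpan_eq_range]; rfl

theorem finrank_colSpan (A : Matrix (Fin n) (Fin m) ℝ) :
    Module.finrank ℝ (colSpan A) = A.rank := by
  rw [colSpan_eq_range]; rfl

theorem colSpan_le_colSpan_iff {U : Matrix (Fin n) (Fin m) ℝ} {B : Matrix (Fin n) (Fin q) ℝ} :
    colSpan B ≤ colSpan U ↔ ∃ K : Matrix (Fin m) (Fin q) ℝ, B = U * K := by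
  constructor
  · intro h
    choose K hK using fun j => mem_colSpan.1 (h (Submodule.subset_span ⟨j, rfl⟩))
    exact ⟨(of K)ᵀ, by ext i j; exact (congrFun (hK j) i).symm⟩
  · rintro ⟨K, rfl⟩ x hx
    obtain ⟨y, rfl⟩ := mem_colSpan.1 hx
    exact mem_colSpan.2 ⟨K *ᵥ y, mulVec_mulVec _ _ _⟩

theorem colSpan_mul_of_mul_eq_one (A : Matrix (Fin n) (Fin m) ℝ)
    {K : Matrix (Fin m) (Fin q) ℝ} {L : Matrix (Fin q) (Fin m) ℝ} (h : K * L = 1) :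
    colSpan (A * K) = colSpan A :=
  le_antisymm (colSpan_le_colSpan_iff.2 ⟨K, rfl⟩)
    (colSpan_le_colSpan_iff.2 ⟨L, by rw [Matrix.mul_assoc, h, Matrix.mul_one]⟩)

theorem colSpan_mul_mono (R : Matrix (Fin q) (Fin n) ℝ) {m' : ℕ} {B : Matrix (Fin n) (Fin m) ℝ}
    {U : Matrix (Fin n) (Fin m') ℝ} (h : colSpan B ≤ colSpan U) :
    colSpan (R * B) ≤ colSpan (R * U) := by
  obtain ⟨K, rfl⟩ := colSpan_le_colSpan_iff.1 h
  exact colSpan_le_colSpan_iff.2 ⟨K, (Matrix.mul_assoc R U K).symm⟩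

theorem mul_transpose_mul_of_colSpan_le {U : Matrix (Fin n) (Fin m) ℝ}
    {B : Matrix (Fin n) (Fin q) ℝ} (hU : Uᵀ * U = 1) (h : colSpan B ≤ colSpan U) :
    U * Uᵀ * B = B := by
  obtain ⟨K, rfl⟩ := colSpan_le_colSpan_iff.1 h
  rw [Matrix.mul_assoc, ← Matrix.mul_assoc Uᵀ, hU, Matrix.one_mul]

theorem rank_eq_of_transpose_mul_self {U : Matrix (Fin n) (Fin m) ℝ} (hU : Uᵀ * U = 1) :
    U.rank = m := by
  rw [← rank_transpose_mul_self, hU, rank_one, Fintype.card_fin]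

theorem exists_orthonormal_columns (S : Submodule ℝ (Fin n → ℝ)) (hq : q ≤ Module.finrank ℝ S) :
    ∃ U : Matrix (Fin n) (Fin q) ℝ, Uᵀ * U = 1 ∧ colSpan U ≤ S := by
  let e : EuclideanSpace ℝ (Fin n) ≃ₗ[ℝ] (Fin n → ℝ) := WithLp.linearEquiv 2 ℝ (Fin n → ℝ)
  let T : Submodule ℝ (EuclideanSpace ℝ (Fin n)) := S.comap e.toLinearMap
  replace hq : q ≤ Module.finrank ℝ T := by
    rwa [show T = _ from Submodule.comap_equiv_eq_map_symm e S, LinearEquiv.finrank_map_eq e.symm S]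
  let v : Fin q → T := fun j => stdOrthonormalBasis ℝ T (Fin.castLE hq j)
  have hv : Orthonormal ℝ v :=
    (stdOrthonormalBasis ℝ T).orthonormal.comp _ (Fin.castLE_injective hq)
  refine ⟨of fun i j => (v j : EuclideanSpace ℝ (Fin n)) i, ?_, Submodule.span_le.2 ?_⟩
  · ext i j
    rw [one_apply, ← orthonormal_iff_ite.1 hv i j, Submodule.coe_inner, PiLp.inner_apply, mul_apply]
    exact Finset.sum_congr rfl fun k _ => mul_comm _ _
  · rintro _ ⟨j, rfl⟩
    exact (v j).2

theorem exists_orthonormal_complement (U : Matrix (Fin n) (Fin m) ℝ) (h : m + q ≤ n) :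
    ∃ V : Matrix (Fin n) (Fin q) ℝ, Vᵀ * V = 1 ∧ Uᵀ * V = 0 := by
  have hrank : q ≤ Module.finrank ℝ (LinearMap.ker Uᵀ.mulVecLin) := by
    have h1 := LinearMap.finrank_range_add_finrank_ker Uᵀ.mulVecLin
    have h2 := Submodule.finrank_le (LinearMap.range Uᵀ.mulVecLin)
    simp only [Module.finrank_fin_fun] at h1 h2
    omega
  obtain ⟨V, hV, hle⟩ := exists_orthonormal_columns _ hrank
  refine ⟨V, hV, ?_⟩
  ext i j
  exact congrFun (LinearMap.mem_ker.1 (hle (Submodule.subset_span ⟨j, rfl⟩))) i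

end ColumnSpace

section OrthonormalBasis

variable {p n : ℕ} {A : Matrix (Fin n) (Fin n) ℝ} {U : Matrix (Fin n) (Fin p) ℝ}

theorem exists_isOrthonormalBasisOfSpan (hA : A.rank = p) :
    ∃ U : Matrix (Fin n) (Fin p) ℝ, IsOrthonormalBasisOfSpan U A := by
  obtain ⟨U, hU, hle⟩ := exists_orthonormal_columns (q := p) (colSpan A)
    (by rw [finrank_colSpan, hA])
  refine ⟨U, hU, Submodule.eq_of_le_of_finrank_eq hle ?_⟩
  rw [finrank_colSpan, finrank_colSpan, hA, rank_eq_of_transpose_mul_self hU]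

theorem IsOrthonormalBasisOfSpan.mul_orthogonal {O : Matrix (Fin p) (Fin p) ℝ}
    (hU : IsOrthonormalBasisOfSpan U A) (hO : O ∈ orthogonalGroup (Fin p) ℝ) :
    IsOrthonormalBasisOfSpan (U * O) A := by
  refine ⟨?_, (colSpan_mul_of_mul_eq_one U ((mem_orthogonalGroup_iff _ _).1 hO)).trans hU.2⟩
  rw [transpose_mul, Matrix.mul_assoc, ← Matrix.mul_assoc Uᵀ, hU.1, Matrix.one_mul]
  exact (mem_orthogonalGroup_iff' _ _).1 hO

theorem IsOrthonormalBasisOfSpan.exists_eq_mul {Y : Matrix (Fin n) (Fin p) ℝ}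
    (hU : IsOrthonormalBasisOfSpan U A) (hY : IsOrthonormalBasisOfSpan Y A) :
    ∃ O ∈ orthogonalGroup (Fin p) ℝ, Y = U * O := by
  obtain ⟨O, rfl⟩ := colSpan_le_colSpan_iff.1 (hY.2.trans hU.2.symm).le
  refine ⟨O, (mem_orthogonalGroup_iff' _ _).2 ?_, rfl⟩
  have hY1 := hY.1
  rwa [transpose_mul, Matrix.mul_assoc, ← Matrix.mul_assoc Uᵀ, hU.1, Matrix.one_mul] at hY1

theorem IsOrthonormalBasisOfSpan.mul_transpose_mul (hU : IsOrthonormalBasisOfSpan U A) :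
    U * Uᵀ * A = A :=
  mul_transpose_mul_of_colSpan_le hU.1 hU.2.ge

end OrthonormalBasis

section GeometricMean

variable {m : ℕ} {A B : Matrix (Fin m) (Fin m) ℝ}

theorem transpose_sqrt (A : Matrix (Fin m) (Fin m) ℝ) : (CFC.sqrt A)ᵀ = CFC.sqrt A := by
  rw [← conjTranspose_eq_transpose_of_trivial]
  exact (nonneg_iff_posSemidef.1 (CFC.sqrt_nonneg A)).isHermitian

theorem isUnit_det_sqrt (hA : A.PosDef) : IsUnit (CFC.sqrt A).det := by
  refine isUnit_of_mul_isUnit_left (y := (CFC.sqrt A).det) ?_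
  rw [← det_mul, CFC.sqrt_mul_sqrt_self A hA.posSemidef.nonneg]
  exact hA.det_pos.ne'.isUnit

theorem posSemidef_inv_sqrt_mul_mul_inv_sqrt (A : Matrix (Fin m) (Fin m) ℝ) (hB : B.PosSemidef) :
    ((CFC.sqrt A)⁻¹ * B * (CFC.sqrt A)⁻¹).PosSemidef := by
  simpa only [conjTranspose_eq_transpose_of_trivial, transpose_nonsing_inv, transpose_sqrt] using
    hB.mul_mul_conjTranspose_same (CFC.sqrt A)⁻¹

theorem transpose_geomMean (A B : Matrix (Fin m) (Fin m) ℝ) :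
    (geomMean A B)ᵀ = geomMean A B := by
  simp only [geomMean, transpose_mul, transpose_sqrt, Matrix.mul_assoc]

theorem exists_geomMean_eq_transpose_mul (hA : A.PosDef) (hB : B.PosSemidef) :
    ∃ S T : Matrix (Fin m) (Fin m) ℝ, Sᵀ * S = A ∧ Tᵀ * T = B ∧ geomMean A B = Sᵀ * T := by
  set S := CFC.sqrt A with hS
  set C := CFC.sqrt (S⁻¹ * B * S⁻¹) with hC
  have hSu : IsUnit S.det := isUnit_det_sqrt hA
  have hCC : C * C = S⁻¹ * B * S⁻¹ :=
    CFC.sqrt_mul_sqrt_self _ (posSemidef_inv_sqrt_mul_mul_inv_sqrt A hB).nonneg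
  refine ⟨S, C * S, ?_, ?_, ?_⟩
  · rw [hS, transpose_sqrt, CFC.sqrt_mul_sqrt_self A hA.posSemidef.nonneg]
  · calc (C * S)ᵀ * (C * S) = S * (C * C) * S := by
          rw [transpose_mul, hC, transpose_sqrt, hS, transpose_sqrt]; simp only [Matrix.mul_assoc]
      _ = (S * S⁻¹) * B * (S⁻¹ * S) := by rw [hCC]; simp only [Matrix.mul_assoc]
      _ = B := by rw [mul_nonsing_inv _ hSu, nonsing_inv_mul _ hSu, Matrix.one_mul, Matrix.mul_one]
  · rw [geomMean, hS, transpose_sqrt, Matrix.mul_assoc]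

theorem dotProduct_geomMean_mulVec_sq_le (hA : A.PosDef) (hB : B.PosSemidef) (x y : Fin m → ℝ) :
    (x ⬝ᵥ (geomMean A B *ᵥ y)) ^ 2 ≤ (x ⬝ᵥ (A *ᵥ x)) * (y ⬝ᵥ (B *ᵥ y)) := by
  obtain ⟨S, T, rfl, rfl, hST⟩ := exists_geomMean_eq_transpose_mul hA hB
  rw [hST]
  simp only [← mulVec_dotProduct_mulVec]
  simpa only [dotProduct, sq] using
    Finset.sum_mul_sq_le_sq_mul_sq Finset.univ (S *ᵥ x) (T *ᵥ y)

theorem tendsto_dotProduct_geomMean_mulVec {α : Type*} {l : Filter α}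
    {X Y : α → Matrix (Fin m) (Fin m) ℝ} (hX : ∀ k, (X k).PosDef) (hY : ∀ k, (Y k).PosSemidef)
    (hXA : Tendsto X l (𝓝 A)) (hYB : Tendsto Y l (𝓝 B)) {x y : Fin m → ℝ}
    (h : (x ⬝ᵥ (A *ᵥ x)) * (y ⬝ᵥ (B *ᵥ y)) = 0) :
    Tendsto (fun k => x ⬝ᵥ (geomMean (X k) (Y k) *ᵥ y)) l (𝓝 0) := by
  have hquad (z : Fin m → ℝ) : Continuous fun M : Matrix (Fin m) (Fin m) ℝ => z ⬝ᵥ (M *ᵥ z) := by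
    fun_prop
  have hbound := (((hquad x).tendsto A).comp hXA).mul (((hquad y).tendsto B).comp hYB)
  rw [h] at hbound
  have hsq : Tendsto (fun k => (x ⬝ᵥ (geomMean (X k) (Y k) *ᵥ y)) ^ 2) l (𝓝 0) :=
    squeeze_zero (fun k => sq_nonneg _)
      (fun k => dotProduct_geomMean_mulVec_sq_le (hX k) (hY k) x y) hbound
  rw [tendsto_zero_iff_abs_tendsto_zero]
  simpa only [Function.comp_def, Real.sqrt_sq_eq_abs, Real.sqrt_zero] using hsq.sqrt

end GeometricMean

section AndoMean

theorem ker_sup_ker_eq_top_of_isSymmetric {𝕜 E : Type*} [RCLike 𝕜] [NormedAddCommGroup E]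
    [InnerProductSpace 𝕜 E] [FiniteDimensional 𝕜 E] {S T : E →ₗ[𝕜] E} (hS : S.IsSymmetric)
    (hT : T.IsSymmetric) (h : Disjoint (LinearMap.range S) (LinearMap.range T)) :
    LinearMap.ker S ⊔ LinearMap.ker T = ⊤ := by
  rw [← Submodule.orthogonal_eq_bot_iff, ← Submodule.inf_orthogonal, ← hS.orthogonal_range,
    ← hT.orthogonal_range, Submodule.orthogonal_orthogonal, Submodule.orthogonal_orthogonal]
  exact h.eq_bot

variable {n : ℕ} {A B : Matrix (Fin n) (Fin n) ℝ}

theorem exists_add_eq_of_colSpan_inf_colSpan_eq_bot (hA : A.IsHermitian) (hB : B.IsHermitian)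
    (h : colSpan A ⊓ colSpan B = ⊥) (x : Fin n → ℝ) :
    ∃ a b, A *ᵥ a = 0 ∧ B *ᵥ b = 0 ∧ a + b = x := by
  have hdisj : Disjoint (LinearMap.range (toEuclideanLin A))
      (LinearMap.range (toEuclideanLin B)) := by
    rw [Submodule.disjoint_def]
    rintro _ ⟨u, rfl⟩ ⟨v, hv⟩
    have hmem : A *ᵥ u.ofLp ∈ colSpan A ⊓ colSpan B :=
      ⟨mem_colSpan.2 ⟨_, rfl⟩, mem_colSpan.2 ⟨v.ofLp, congrArg WithLp.ofLp hv⟩⟩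
    rw [h] at hmem
    exact congrArg (WithLp.toLp 2) hmem
  have htop := ker_sup_ker_eq_top_of_isSymmetric (isSymmetric_toEuclideanLin_iff.2 hA)
    (isSymmetric_toEuclideanLin_iff.2 hB) hdisj
  obtain ⟨a, ha, b, hb, hab⟩ :=
    Submodule.mem_sup.1 (htop ▸ Submodule.mem_top (x := WithLp.toLp 2 x))
  exact ⟨a.ofLp, b.ofLp, congrArg WithLp.ofLp ha, congrArg WithLp.ofLp hb,
    congrArg WithLp.ofLp hab⟩

theorem isAndoMean_zero (hA : A.PosSemidef) (hB : B.PosSemidef)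
    (h : colSpan A ⊓ colSpan B = ⊥) : IsAndoMean A B 0 := by
  refine ⟨hA, hB, fun X Y ⟨hX, _, hXA⟩ ⟨hY, _, hYB⟩ => ?_⟩
  have hlim {x y} := tendsto_dotProduct_geomMean_mulVec (x := x) (y := y) hX
    (fun k => (hY k).posSemidef) hXA hYB
  have hform (x y : Fin n → ℝ) :
      Tendsto (fun k => x ⬝ᵥ (geomMean (X k) (Y k) *ᵥ y)) atTop (𝓝 0) := by
    obtain ⟨a, b, ha, hb, rfl⟩ :=
      exists_add_eq_of_colSpan_inf_colSpan_eq_bot hA.isHermitian hB.isHermitian h x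
    have hsymm (k : ℕ) : b ⬝ᵥ (geomMean (X k) (Y k) *ᵥ y) = y ⬝ᵥ (geomMean (X k) (Y k) *ᵥ b) := by
      rw [dotProduct_mulVec, ← mulVec_transpose, transpose_geomMean, dotProduct_comm]
    simp only [add_dotProduct, hsymm]
    simpa only [add_zero] using
      (hlim (x := a) (y := y) (by rw [ha, dotProduct_zero, zero_mul])).add
        (hlim (x := y) (y := b) (by rw [hb, dotProduct_zero, mul_zero]))
  refine tendsto_pi_nhds.2 fun i => tendsto_pi_nhds.2 fun j => ?_
  simpa using hform (Pi.single i 1) (Pi.single j 1)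

end AndoMean

section Exponential

theorem exp_smul_mul_eq_cos_smul_add_sin_smul {𝔸 : Type*} [NormedRing 𝔸] [NormedAlgebra ℝ 𝔸]
    [CompleteSpace 𝔸] {a b c : 𝔸} (hb : a * b = c) (hc : a * c = -b) (t : ℝ) :
    NormedSpace.exp (t • a) * b = Real.cos t • b + Real.sin t • c := by
  have hderiv (s : ℝ) : HasDerivAt
      (fun s => NormedSpace.exp ((t - s) • a) * (Real.cos s • b + Real.sin s • c)) 0 s := by
    have hexp := (hasDerivAt_exp_smul_const a (t - s)).comp_const_sub t s
    have htrig := ((Real.hasDerivAt_cos s).smul_const b).add ((Real.hasDerivAt_sin s).smul_const c)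
    refine (hexp.mul htrig).congr_deriv ?_
    simp only [Pi.add_apply, neg_mul, mul_assoc, mul_add, mul_smul_comm, hb, hc, mul_neg]
    module
  have hconst := is_const_of_deriv_eq_zero (fun s => (hderiv s).differentiableAt)
    (fun s => (hderiv s).deriv) 0 t
  simpa using hconst

variable {n p : ℕ}

section
attribute [local instance] Matrix.linftyOpNormedRing Matrix.linftyOpNormedAlgebra

theorem continuous_matrix_exp :
    Continuous (NormedSpace.exp : Matrix (Fin n) (Fin n) ℝ → Matrix (Fin n) (Fin n) ℝ) :=
  NormedSpace.exp_continuous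

theorem exp_smul_sub_mul {U V : Matrix (Fin n) (Fin p) ℝ} (hU : Uᵀ * U = 1) (hV : Vᵀ * V = 1)
    (hUV : Uᵀ * V = 0) (t : ℝ) :
    NormedSpace.exp (t • (V * Uᵀ - U * Vᵀ)) * U = Real.cos t • U + Real.sin t • V := by
  have hVU : Vᵀ * U = 0 := by simpa using congrArg transpose hUV
  have hJU : (V * Uᵀ - U * Vᵀ) * (U * Uᵀ) = V * Uᵀ := by
    rw [← Matrix.mul_assoc, Matrix.sub_mul, Matrix.mul_assoc V, Matrix.mul_assoc U, hU, hVU]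
    simp
  have hJV : (V * Uᵀ - U * Vᵀ) * (V * Uᵀ) = -(U * Uᵀ) := by
    rw [← Matrix.mul_assoc, Matrix.sub_mul, Matrix.mul_assoc V, Matrix.mul_assoc U, hV, hUV]
    simp
  have hrot : NormedSpace.exp (t • (V * Uᵀ - U * Vᵀ)) * (U * Uᵀ) =
      Real.cos t • (U * Uᵀ) + Real.sin t • (V * Uᵀ) :=
    exp_smul_mul_eq_cos_smul_add_sin_smul hJU hJV t
  simpa only [Matrix.add_mul, Matrix.smul_mul, Matrix.mul_assoc, hU, Matrix.mul_one] using
    congrArg (· * U) hrot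

end

theorem exp_mem_orthogonalGroup {Ω : Matrix (Fin n) (Fin n) ℝ} (hΩ : Ωᵀ = -Ω) :
    NormedSpace.exp Ω ∈ orthogonalGroup (Fin n) ℝ := by
  refine (mem_orthogonalGroup_iff' _ _).2 ?_
  have hdet : IsUnit (NormedSpace.exp Ω).det := (isUnit_iff_isUnit_det _).1 (isUnit_exp Ω)
  rw [← exp_transpose, hΩ, exp_neg, nonsing_inv_mul _ hdet]

theorem exp_mem_specialOrthogonalGroup {Ω : Matrix (Fin n) (Fin n) ℝ} (hΩ : Ωᵀ = -Ω) :
    NormedSpace.exp Ω ∈ specialOrthogonalGroup (Fin n) ℝ := by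
  refine mem_specialOrthogonalGroup_iff.2 ⟨exp_mem_orthogonalGroup hΩ, ?_⟩
  -- `exp Ω` is the square of the orthogonal matrix `exp (Ω / 2)`, whose determinant is `±1`.
  have hhalf : ((1 / 2 : ℝ) • Ω)ᵀ = -((1 / 2 : ℝ) • Ω) := by rw [transpose_smul, hΩ, smul_neg]
  have horth := congrArg det ((mem_orthogonalGroup_iff' _ _).1 (exp_mem_orthogonalGroup hhalf))
  have hsq : NormedSpace.exp Ω =
      NormedSpace.exp ((1 / 2 : ℝ) • Ω) * NormedSpace.exp ((1 / 2 : ℝ) • Ω) := by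
    rw [← exp_add_of_commute _ _ (Commute.refl _), ← add_smul]
    norm_num
  rwa [det_mul, det_transpose, det_one, ← det_mul, ← hsq] at horth

end Exponential

section RotationMagnitude

variable {n : ℕ}

theorem rotationMagnitude_exp_le {Ω : Matrix (Fin n) (Fin n) ℝ} (hΩ : Ωᵀ = -Ω) :
    rotationMagnitude (NormedSpace.exp Ω) ≤ ENNReal.ofReal √(Ωᵀ * Ω).trace :=
  iInf₂_le Ω ⟨hΩ, rfl⟩

theorem tendsto_rotationMagnitude_exp_smul {Ω : Matrix (Fin n) (Fin n) ℝ} (hΩ : Ωᵀ = -Ω) :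
    Tendsto (fun t : ℝ => rotationMagnitude (NormedSpace.exp (t • Ω))) (𝓝 0) (𝓝 0) := by
  have hcont : Continuous fun t : ℝ => ENNReal.ofReal √((t • Ω)ᵀ * (t • Ω)).trace :=
    ENNReal.continuous_ofReal.comp (by fun_prop)
  have hlim : Tendsto (fun t : ℝ => ENNReal.ofReal √((t • Ω)ᵀ * (t • Ω)).trace) (𝓝 0) (𝓝 0) := by
    simpa using hcont.tendsto 0
  refine tendsto_of_tendsto_of_tendsto_of_le_of_le tendsto_const_nhds hlim (fun _ => zero_le)
    fun t => rotationMagnitude_exp_le ?_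
  rw [transpose_smul, hΩ, smul_neg]

section
attribute [local instance] Matrix.frobeniusNormedAddCommGroup

theorem frobenius_norm_eq_sqrt_trace {ι κ : Type*} [Fintype ι] [Fintype κ] (A : Matrix ι κ ℝ) :
    ‖A‖ = √(Aᵀ * A).trace := by
  rw [frobenius_norm_def, ← Real.sqrt_eq_rpow, trace, Finset.sum_comm]
  simp only [diag_apply, mul_apply, transpose_apply, Real.rpow_two, Real.norm_eq_abs, sq_abs]
  simp only [sq]

theorem exists_forall_rotationMagnitude_lt_mem {V : Set (Matrix (Fin n) (Fin n) ℝ)}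
    (hV : V ∈ 𝓝 1) :
    ∃ δ : ℝ≥0∞, 0 < δ ∧ ∀ R : Matrix (Fin n) (Fin n) ℝ, rotationMagnitude R < δ → R ∈ V := by
  have hexp : NormedSpace.exp ⁻¹' V ∈ 𝓝 (0 : Matrix (Fin n) (Fin n) ℝ) :=
    continuous_matrix_exp.continuousAt.preimage_mem_nhds (by rwa [NormedSpace.exp_zero])
  obtain ⟨ε, hε, hball⟩ := Metric.mem_nhds_iff.1 hexp
  refine ⟨ENNReal.ofReal ε, ENNReal.ofReal_pos.2 hε, fun R hR => ?_⟩
  obtain ⟨Ω, hR⟩ := iInf_lt_iff.1 hR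
  obtain ⟨⟨_, rfl⟩, hΩ⟩ := iInf_lt_iff.1 hR
  refine hball (mem_ball_zero_iff.2 ?_)
  rw [frobenius_norm_eq_sqrt_trace]
  exact (ENNReal.ofReal_lt_ofReal_iff hε).1 hΩ

end

theorem rotationMagnitude_pos {R : Matrix (Fin n) (Fin n) ℝ} (hR : R ≠ 1) :
    0 < rotationMagnitude R := by
  obtain ⟨δ, hδ, h⟩ := exists_forall_rotationMagnitude_lt_mem (isOpen_ne.mem_nhds hR.symm)
  exact hδ.trans_le (not_lt.1 fun hlt => h R hlt rfl)

end RotationMagnitude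

section DisjointRotation

variable {p n : ℕ} {A R : Matrix (Fin n) (Fin n) ℝ}

theorem colSpan_add_smul_inf_colSpan {m : ℕ} {U : Matrix (Fin n) (Fin m) ℝ}
    {V W : Matrix (Fin n) (Fin p) ℝ}
    (hV : Vᵀ * V = 1) (hVU : Vᵀ * U = 0) (hVW : Vᵀ * W = 0) {b : ℝ} (hb : b ≠ 0) :
    colSpan (W + b • V) ⊓ colSpan U = ⊥ := by
  refine (Submodule.eq_bot_iff _).2 fun x ⟨hx, hxU⟩ => ?_
  obtain ⟨y, rfl⟩ := mem_colSpan.1 hx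
  obtain ⟨z, hz⟩ := mem_colSpan.1 hxU
  have hby : 0 = b • y := by
    simpa only [mulVec_mulVec, hVU, hVW, hV, Matrix.mul_add, Matrix.mul_smul, zero_add, zero_mulVec,
      smul_mulVec, one_mulVec] using congrArg (Vᵀ *ᵥ ·) hz
  rw [(smul_eq_zero.1 hby.symm).resolve_left hb, mulVec_zero]

theorem colSpan_conj {U : Matrix (Fin n) (Fin p) ℝ} (hR : R ∈ orthogonalGroup (Fin n) ℝ)
    (h : colSpan U = colSpan A) : colSpan (R * A * Rᵀ) = colSpan (R * U) := by
  rw [colSpan_mul_of_mul_eq_one _ ((mem_orthogonalGroup_iff' _ _).1 hR)]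
  exact le_antisymm (colSpan_mul_mono R h.ge) (colSpan_mul_mono R h.le)

theorem colSpan_ne_bot (hA : 0 < A.rank) : colSpan A ≠ ⊥ := fun h => by
  rw [← finrank_colSpan, h, finrank_bot] at hA
  exact hA.false

theorem exists_rotation_colSpan_inf_eq_bot (hA : 0 < A.rank) (hAn : 2 * A.rank ≤ n) {δ : ℝ≥0∞}
    (hδ : 0 < δ) :
    ∃ R ∈ specialOrthogonalGroup (Fin n) ℝ, 0 < rotationMagnitude R ∧ rotationMagnitude R < δ ∧
      colSpan (R * A * Rᵀ) ⊓ colSpan A = ⊥ := by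
  obtain ⟨U, hU, hUA⟩ := exists_isOrthonormalBasisOfSpan (A := A) rfl
  obtain ⟨V, hV, hUV⟩ := exists_orthonormal_complement (q := A.rank) U (by omega)
  have hVU : Vᵀ * U = 0 := by simpa using congrArg transpose hUV
  set J := V * Uᵀ - U * Vᵀ with hJ_def
  have hJ : Jᵀ = -J := by simp [hJ_def]
  obtain ⟨t, ht, ht0, htπ⟩ : ∃ t : ℝ, rotationMagnitude (NormedSpace.exp (t • J)) < δ ∧
      0 < t ∧ t < Real.pi :=
    ((((tendsto_rotationMagnitude_exp_smul hJ).mono_left nhdsWithin_le_nhds).eventually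
      (gt_mem_nhds hδ)).and (Ioo_mem_nhdsGT Real.pi_pos)).exists
  have hR := exp_mem_specialOrthogonalGroup (Ω := t • J) (by rw [transpose_smul, hJ, smul_neg])
  have hdisj : colSpan (NormedSpace.exp (t • J) * A * (NormedSpace.exp (t • J))ᵀ) ⊓ colSpan A
      = ⊥ := by
    rw [colSpan_conj (mem_specialOrthogonalGroup_iff.1 hR).1 hUA, ← hUA,
      exp_smul_sub_mul hU hV hUV]
    exact colSpan_add_smul_inf_colSpan hV hVU (by rw [Matrix.mul_smul, hVU, smul_zero])
      (Real.sin_pos_of_pos_of_lt_pi ht0 htπ).ne'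
  refine ⟨_, hR, rotationMagnitude_pos fun h1 => colSpan_ne_bot hA ?_, ht, hdisj⟩
  rwa [h1, Matrix.one_mul, transpose_one, Matrix.mul_one, inf_idem] at hdisj

end DisjointRotation

section Compression

variable {p n : ℕ} {A B : Matrix (Fin n) (Fin n) ℝ} {U Y : Matrix (Fin n) (Fin p) ℝ}

theorem IsOrthonormalBasisOfSpan.mul_mul_transpose (hU : IsOrthonormalBasisOfSpan U A)
    (hA : A.IsHermitian) : A * (U * Uᵀ) = A := by
  have hAt : Aᵀ = A := conjTranspose_eq_transpose_of_trivial A ▸ hA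
  simpa only [transpose_mul, transpose_transpose, hAt] using congrArg transpose hU.mul_transpose_mul

theorem IsOrthonormalBasisOfSpan.mul_compression_mul (hU : IsOrthonormalBasisOfSpan U A)
    (hA : A.IsHermitian) : U * (Uᵀ * A * U) * Uᵀ = A := by
  calc U * (Uᵀ * A * U) * Uᵀ = U * Uᵀ * (A * (U * Uᵀ)) := by simp only [Matrix.mul_assoc]
    _ = A := by rw [hU.mul_mul_transpose hA, hU.mul_transpose_mul]

theorem posSemidef_compression (hA : A.PosSemidef) (U : Matrix (Fin n) (Fin p) ℝ) :
    (Uᵀ * A * U).PosSemidef := by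
  simpa only [conjTranspose_eq_transpose_of_trivial] using hA.conjTranspose_mul_mul_same U

theorem IsOrthonormalBasisOfSpan.posDef_compression (hU : IsOrthonormalBasisOfSpan U A)
    (hA : A.PosSemidef) : (Uᵀ * A * U).PosDef := by
  refine (posSemidef_compression hA U).posDef_iff_isUnit.2
    (mulVec_surjective_iff_isUnit.1 fun y => ?_)
  obtain ⟨z, hz⟩ : ∃ z, A *ᵥ z = U *ᵥ y := mem_colSpan.1 (hU.2 ▸ mem_colSpan.2 ⟨y, rfl⟩)
  refine ⟨Uᵀ *ᵥ z, ?_⟩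
  rw [mulVec_mulVec, Matrix.mul_assoc, Matrix.mul_assoc, hU.mul_mul_transpose hA.isHermitian,
    ← mulVec_mulVec, hz, mulVec_mulVec, hU.1, one_mulVec]

end Compression

section OperatorNorm

open scoped Matrix.Norms.L2Operator

variable {ι κ μ : Type*} [Fintype ι] [DecidableEq ι] [Fintype κ] [Fintype μ]

theorem l2_opNorm_transpose [DecidableEq κ] (X : Matrix κ ι ℝ) : ‖Xᵀ‖ = ‖X‖ := by
  rw [← conjTranspose_eq_transpose_of_trivial, l2_opNorm_conjTranspose]

theorem l2_opNorm_mul_self_of_transpose_mul_self_eq_diagonal {X : Matrix κ ι ℝ} {d : ι → ℝ}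
    (hX : Xᵀ * X = diagonal d) : ‖X‖ * ‖X‖ = ‖d‖ := by
  rw [← l2_opNorm_conjTranspose_mul_self, conjTranspose_eq_transpose_of_trivial, hX,
    l2_opNorm_diagonal]

theorem l2_opNorm_le_mul_of_transpose_mul_self_eq_diagonal {X : Matrix κ ι ℝ} {Z : Matrix μ ι ℝ}
    {d e : ι → ℝ} (hX : Xᵀ * X = diagonal d) (hZ : Zᵀ * Z = diagonal e) {c : ℝ} (hc : 0 ≤ c)
    (h : ∀ i, |d i| ≤ c ^ 2 * |e i|) : ‖X‖ ≤ c * ‖Z‖ := by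
  refine abs_le_of_sq_le_sq' ?_ (by positivity) |>.2
  calc ‖X‖ ^ 2 = ‖d‖ := by rw [sq, l2_opNorm_mul_self_of_transpose_mul_self_eq_diagonal hX]
    _ ≤ c ^ 2 * ‖e‖ := (pi_norm_le_iff_of_nonneg (by positivity)).2 fun i =>
        (h i).trans (by gcongr; exact norm_le_pi_norm e i)
    _ = (c * ‖Z‖) ^ 2 := by
        rw [← l2_opNorm_mul_self_of_transpose_mul_self_eq_diagonal hZ]; ring

theorem l2_opNorm_le_one_of_transpose_mul_self {X : Matrix κ ι ℝ} (hX : Xᵀ * X = 1) :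
    ‖X‖ ≤ 1 := by
  have h := l2_opNorm_mul_self_of_transpose_mul_self_eq_diagonal (hX.trans diagonal_one.symm)
  have h1 : ‖(1 : ι → ℝ)‖ ≤ 1 := (pi_norm_le_iff_of_nonneg zero_le_one).2 fun _ => by simp
  exact abs_le_one_iff_mul_self_le_one.2 (h.trans_le h1) |> (le_abs_self _).trans

theorem l2_opNorm_one_sub_mul_transpose_le [DecidableEq κ] {X : Matrix κ ι ℝ} (hX : Xᵀ * X = 1) :
    ‖1 - X * Xᵀ‖ ≤ 1 := by
  have hproj : IsStarProjection (X * Xᵀ) := by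
    refine ⟨?_, ?_⟩
    · rw [IsIdempotentElem, Matrix.mul_assoc, ← Matrix.mul_assoc Xᵀ, hX, Matrix.one_mul]
    · rw [IsSelfAdjoint, star_eq_conjTranspose, conjTranspose_eq_transpose_of_trivial,
        transpose_mul, transpose_transpose]
  exact hproj.one_sub.norm_le

theorem l2_opNorm_mul_mul_le [DecidableEq μ] {X : Matrix κ ι ℝ} {Z : Matrix ι μ ℝ}
    (hX : ‖X‖ ≤ 1) (hZ : ‖Z‖ ≤ 1) (M : Matrix ι ι ℝ) : ‖X * M * Z‖ ≤ ‖M‖ := by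
  calc ‖X * M * Z‖ ≤ ‖X‖ * ‖M‖ * ‖Z‖ :=
        (l2_opNorm_mul _ _).trans (by gcongr; exact l2_opNorm_mul _ _)
    _ ≤ 1 * ‖M‖ * 1 := by gcongr
    _ = ‖M‖ := by ring

theorem l2_opNorm_conj_sub_conj_le [DecidableEq κ] {X Y : Matrix κ ι ℝ} (hX : ‖X‖ ≤ 1)
    (hY : ‖Y‖ ≤ 1) (A B : Matrix ι ι ℝ) :
    ‖X * B * Xᵀ - Y * A * Yᵀ‖ ≤ ‖B - A‖ + 2 * ‖A‖ * ‖X - Y‖ := by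
  have hXt : ‖Xᵀ‖ ≤ 1 := (l2_opNorm_transpose X).trans_le hX
  have hYt : ‖Yᵀ‖ ≤ 1 := (l2_opNorm_transpose Y).trans_le hY
  have hleft : ‖X * A * (X - Y)ᵀ‖ ≤ ‖A‖ * ‖X - Y‖ :=
    calc ‖X * A * (X - Y)ᵀ‖ ≤ ‖X‖ * ‖A‖ * ‖(X - Y)ᵀ‖ :=
          (l2_opNorm_mul _ _).trans (by gcongr; exact l2_opNorm_mul _ _)
      _ ≤ 1 * ‖A‖ * ‖X - Y‖ := by rw [l2_opNorm_transpose]; gcongr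
      _ = ‖A‖ * ‖X - Y‖ := by ring
  have hright : ‖(X - Y) * A * Yᵀ‖ ≤ ‖A‖ * ‖X - Y‖ :=
    calc ‖(X - Y) * A * Yᵀ‖ ≤ ‖X - Y‖ * ‖A‖ * ‖Yᵀ‖ :=
          (l2_opNorm_mul _ _).trans (by gcongr; exact l2_opNorm_mul _ _)
      _ ≤ ‖X - Y‖ * ‖A‖ * 1 := by gcongr
      _ = ‖A‖ * ‖X - Y‖ := by ring
  have hsplit : X * B * Xᵀ - Y * A * Yᵀ =
      X * (B - A) * Xᵀ + X * A * (X - Y)ᵀ + (X - Y) * A * Yᵀ := by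
    simp only [transpose_sub, Matrix.mul_sub, Matrix.sub_mul]
    abel
  rw [hsplit]
  exact norm_add₃_le.trans (by linarith [l2_opNorm_mul_mul_le hX hXt (B - A)])

end OperatorNorm

section GeometricMeanNorm

theorem norm_sqrt_sub_one_le {𝒜 : Type*} [NormedRing 𝒜] [StarRing 𝒜] [NormedAlgebra ℝ 𝒜]
    [PartialOrder 𝒜] [StarOrderedRing 𝒜] [NonnegSpectrumClass ℝ 𝒜]
    [IsometricContinuousFunctionalCalculus ℝ 𝒜 IsSelfAdjoint] {a : 𝒜} (ha : 0 ≤ a) :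
    ‖CFC.sqrt a - 1‖ ≤ ‖a - 1‖ := by
  have hsa : IsSelfAdjoint a := .of_nonneg ha
  have hsqrt : CFC.sqrt a - 1 = cfc (fun x : ℝ => √x - 1) a := by
    rw [cfc_sub .., cfc_const_one .., CFC.sqrt_eq_real_sqrt a, cfcₙ_eq_cfc]
  have hid : a - 1 = cfc (fun x : ℝ => x - 1) a := by
    rw [cfc_sub .., cfc_const_one .., cfc_id' ..]
  rw [hsqrt]
  refine norm_cfc_le (norm_nonneg _) fun x hx => ?_
  have hx0 : 0 ≤ x := spectrum_nonneg_of_nonneg ha hx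
  calc ‖√x - 1‖ ≤ ‖√x - 1‖ * ‖√x + 1‖ := le_mul_of_one_le_right (norm_nonneg _)
        (le_trans (by linarith [Real.sqrt_nonneg x]) (le_abs_self _))
    _ = ‖x - 1‖ := by rw [← norm_mul]; congr 1; linear_combination Real.mul_self_sqrt hx0
    _ ≤ ‖a - 1‖ := hid ▸ norm_apply_le_norm_cfc (fun x : ℝ => x - 1) a hx

open scoped Matrix.Norms.L2Operator

theorem l2_opNorm_geomMean_sub_le {p : ℕ} {P Q : Matrix (Fin p) (Fin p) ℝ} (hP : P.PosDef)
    (hQ : Q.PosSemidef) : ‖geomMean P Q - P‖ ≤ ‖P‖ * ‖P⁻¹‖ * ‖Q - P‖ := by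
  have hdet : IsUnit (CFC.sqrt P).det := isUnit_det_sqrt hP
  have hsq : CFC.sqrt P * CFC.sqrt P = P := CFC.sqrt_mul_sqrt_self P hP.posSemidef.nonneg
  have hnorm : ∀ {R : Matrix (Fin p) (Fin p) ℝ}, R.PosSemidef →
      ‖CFC.sqrt R‖ * ‖CFC.sqrt R‖ = ‖R‖ := fun {R} hR => by
    rw [← l2_opNorm_conjTranspose_mul_self, conjTranspose_eq_transpose_of_trivial, transpose_sqrt,
      CFC.sqrt_mul_sqrt_self R hR.nonneg]
  set S := CFC.sqrt P with hS
  set T := S⁻¹ * Q * S⁻¹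
  have hmean : geomMean P Q - P = S * (CFC.sqrt T - 1) * S := by
    rw [Matrix.mul_sub, Matrix.sub_mul, Matrix.mul_one, hsq, geomMean]
  have hT1 : T - 1 = S⁻¹ * (Q - P) * S⁻¹ := by
    rw [Matrix.mul_sub, Matrix.sub_mul, ← hsq, ← Matrix.mul_assoc S⁻¹, nonsing_inv_mul _ hdet,
      Matrix.one_mul, mul_nonsing_inv _ hdet]
  have hinv : ‖S⁻¹‖ * ‖S⁻¹‖ = ‖P⁻¹‖ := by
    rw [hS, hP.posSemidef.inv_sqrt, hnorm hP.inv.posSemidef]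
  calc ‖geomMean P Q - P‖ ≤ ‖S‖ * ‖CFC.sqrt T - 1‖ * ‖S‖ := hmean ▸ norm_mul₃_le
    _ ≤ ‖S‖ * ‖T - 1‖ * ‖S‖ := by
        gcongr
        exact norm_sqrt_sub_one_le (posSemidef_inv_sqrt_mul_mul_inv_sqrt P hQ).nonneg
    _ ≤ ‖S‖ * (‖S⁻¹‖ * ‖Q - P‖ * ‖S⁻¹‖) * ‖S‖ := by
        gcongr
        exact hT1 ▸ norm_mul₃_le
    _ = ‖S‖ * ‖S‖ * (‖S⁻¹‖ * ‖S⁻¹‖) * ‖Q - P‖ := by ring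
    _ = ‖P‖ * ‖P⁻¹‖ * ‖Q - P‖ := by rw [hnorm hP.posSemidef, hinv]

end GeometricMeanNorm

section PrincipalAngles

open Real
open scoped Matrix.Norms.L2Operator

variable {p n : ℕ} {A B : Matrix (Fin n) (Fin n) ℝ} {Y₁ Y₂ : Matrix (Fin n) (Fin p) ℝ}
  {θ : Fin p → ℝ}

/-- Orthonormal bases of two `p`-dimensional subspaces of `ℝⁿ` formed by principal vectors for
the principal angles `θ`, which are all assumed to be smaller than `π / 2`. These are the bases
`Y₁, Y₂` entering the definition of the rank-preserving mean. -/
structure IsPrincipalPair (Y₁ Y₂ : Matrix (Fin n) (Fin p) ℝ) (θ : Fin p → ℝ) : Prop where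
  left_orthonormal : Y₁ᵀ * Y₁ = 1
  right_orthonormal : Y₂ᵀ * Y₂ = 1
  transpose_mul : Y₁ᵀ * Y₂ = diagonal fun i => cos (θ i)
  angle_mem : ∀ i, θ i ∈ Set.Ico 0 (π / 2)

namespace IsPrincipalPair

theorem symm (h : IsPrincipalPair Y₁ Y₂ θ) : IsPrincipalPair Y₂ Y₁ θ where
  left_orthonormal := h.right_orthonormal
  right_orthonormal := h.left_orthonormal
  transpose_mul := by
    simpa only [Matrix.transpose_mul, transpose_transpose, diagonal_transpose] using
      congrArg transpose h.transpose_mul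
  angle_mem := h.angle_mem

theorem transpose_sub_mul_sub (h : IsPrincipalPair Y₁ Y₂ θ) :
    (Y₂ - Y₁)ᵀ * (Y₂ - Y₁) = diagonal fun i => 2 - 2 * cos (θ i) := by
  rw [transpose_sub, Matrix.sub_mul, Matrix.mul_sub, Matrix.mul_sub, h.left_orthonormal,
    h.right_orthonormal, h.transpose_mul, h.symm.transpose_mul, ← diagonal_one]
  simp only [diagonal_sub]
  congr 1 with i
  ring

theorem transpose_mul_self_one_sub_proj_mul (h : IsPrincipalPair Y₁ Y₂ θ) :
    ((1 - Y₂ * Y₂ᵀ) * Y₁)ᵀ * ((1 - Y₂ * Y₂ᵀ) * Y₁) = diagonal fun i => 1 - cos (θ i) ^ 2 := by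
  have hperp : Y₂ᵀ * ((1 - Y₂ * Y₂ᵀ) * Y₁) = 0 := by
    rw [← Matrix.mul_assoc, Matrix.mul_sub, ← Matrix.mul_assoc, h.right_orthonormal,
      Matrix.one_mul, Matrix.mul_one, sub_self, Matrix.zero_mul]
  have hF : (1 - Y₂ * Y₂ᵀ) * Y₁ = Y₁ - Y₂ * (Y₂ᵀ * Y₁) := by
    rw [Matrix.sub_mul, Matrix.one_mul, Matrix.mul_assoc]
  calc ((1 - Y₂ * Y₂ᵀ) * Y₁)ᵀ * ((1 - Y₂ * Y₂ᵀ) * Y₁)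
      = Y₁ᵀ * ((1 - Y₂ * Y₂ᵀ) * Y₁) - (Y₂ᵀ * Y₁)ᵀ * (Y₂ᵀ * ((1 - Y₂ * Y₂ᵀ) * Y₁)) := by
        conv_lhs => rw [hF, transpose_sub, Matrix.sub_mul, Matrix.transpose_mul Y₂, ← hF,
          Matrix.mul_assoc]
    _ = 1 - Y₁ᵀ * Y₂ * (Y₂ᵀ * Y₁) := by
        rw [hperp, Matrix.mul_zero, sub_zero, hF, Matrix.mul_sub, h.left_orthonormal,
          Matrix.mul_assoc]
    _ = diagonal fun i => 1 - cos (θ i) ^ 2 := by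
        rw [h.transpose_mul, h.symm.transpose_mul, diagonal_mul_diagonal, ← diagonal_one,
          diagonal_sub]
        simp only [sq]

theorem cos_mem (h : IsPrincipalPair Y₁ Y₂ θ) (i : Fin p) : cos (θ i) ∈ Set.Icc 0 1 :=
  ⟨cos_nonneg_of_mem_Icc ⟨by linarith [(h.angle_mem i).1, pi_pos], (h.angle_mem i).2.le⟩,
    cos_le_one _⟩

theorem l2_opNorm_sub_le (h : IsPrincipalPair Y₁ Y₂ θ) :
    ‖Y₂ - Y₁‖ ≤ 2 * ‖(1 - Y₂ * Y₂ᵀ) * Y₁‖ := by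
  refine l2_opNorm_le_mul_of_transpose_mul_self_eq_diagonal h.transpose_sub_mul_sub
    h.transpose_mul_self_one_sub_proj_mul zero_le_two fun i => ?_
  obtain ⟨h0, h1⟩ := h.cos_mem i
  rw [abs_of_nonneg (by linarith), abs_of_nonneg (by nlinarith)]
  nlinarith

theorem l2_opNorm_one_sub_proj_mul_le (h : IsPrincipalPair Y₁ Y₂ θ)
    (hY₁ : IsOrthonormalBasisOfSpan Y₁ A) (hY₂ : IsOrthonormalBasisOfSpan Y₂ B)
    (hA : A.PosSemidef) :
    ‖(1 - Y₂ * Y₂ᵀ) * Y₁‖ ≤ ‖(Y₁ᵀ * A * Y₁)⁻¹‖ * ‖B - A‖ := by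
  set P := Y₁ᵀ * A * Y₁ with hP
  have hdet : IsUnit P.det := (hY₁.posDef_compression hA).det_pos.ne'.isUnit
  have hYP : Y₁ * P = A * Y₁ := by
    rw [hP, ← Matrix.mul_assoc, ← Matrix.mul_assoc, hY₁.mul_transpose_mul]
  have hB : (1 - Y₂ * Y₂ᵀ) * B = 0 := by
    rw [Matrix.sub_mul, Matrix.one_mul, hY₂.mul_transpose_mul, sub_self]
  have hF : (1 - Y₂ * Y₂ᵀ) * Y₁ = (1 - Y₂ * Y₂ᵀ) * (A - B) * Y₁ * P⁻¹ := by
    rw [Matrix.mul_sub, hB, sub_zero, Matrix.mul_assoc _ A, ← hYP, Matrix.mul_assoc,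
      Matrix.mul_assoc, mul_nonsing_inv _ hdet, Matrix.mul_one]
  calc ‖(1 - Y₂ * Y₂ᵀ) * Y₁‖ ≤ ‖(1 - Y₂ * Y₂ᵀ) * (A - B) * Y₁‖ * ‖P⁻¹‖ := by
        conv_lhs => rw [hF]
        exact l2_opNorm_mul _ _
    _ ≤ ‖A - B‖ * ‖P⁻¹‖ := by
        gcongr
        exact l2_opNorm_mul_mul_le (l2_opNorm_one_sub_mul_transpose_le h.right_orthonormal)
          (l2_opNorm_le_one_of_transpose_mul_self h.left_orthonormal) _
    _ = ‖P⁻¹‖ * ‖B - A‖ := by rw [norm_sub_rev, mul_comm]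

end IsPrincipalPair

theorem grassmannMidpoint_eq (Y₁ Y₂ : Matrix (Fin n) (Fin p) ℝ) (θ : Fin p → ℝ) :
    grassmannMidpoint Y₁ Y₂ θ =
      Y₁ * diagonal (fun i => cos (θ i / 2) - cos (θ i) * ((sin (θ i))⁻¹ * sin (θ i / 2))) +
        Y₂ * diagonal fun i => (sin (θ i))⁻¹ * sin (θ i / 2) := by
  rw [grassmannMidpoint, Matrix.mul_assoc, diagonal_mul_diagonal, Matrix.sub_mul,
    Matrix.mul_assoc, diagonal_mul_diagonal, ← diagonal_sub, Matrix.mul_sub]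
  abel

namespace IsPrincipalPair

theorem left_transpose_mul_grassmannMidpoint (h : IsPrincipalPair Y₁ Y₂ θ) :
    Y₁ᵀ * grassmannMidpoint Y₁ Y₂ θ = diagonal fun i => cos (θ i / 2) := by
  rw [grassmannMidpoint_eq, Matrix.mul_add, ← Matrix.mul_assoc, ← Matrix.mul_assoc,
    h.left_orthonormal, h.transpose_mul, Matrix.one_mul, diagonal_mul_diagonal, diagonal_add]
  congr 1 with i
  ring

theorem right_transpose_mul_grassmannMidpoint (h : IsPrincipalPair Y₁ Y₂ θ) :
    Y₂ᵀ * grassmannMidpoint Y₁ Y₂ θ = diagonal fun i => cos (θ i / 2) := by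
  rw [grassmannMidpoint_eq, Matrix.mul_add, ← Matrix.mul_assoc, ← Matrix.mul_assoc,
    h.right_orthonormal, h.symm.transpose_mul, Matrix.one_mul, diagonal_mul_diagonal, diagonal_add]
  congr 1 with i
  have hsin : sin (θ i) * (sin (θ i))⁻¹ * sin (θ i) = sin (θ i) := mul_inv_mul_cancel _
  have hcos : cos (θ i / 2) = cos (θ i) * cos (θ i / 2) + sin (θ i) * sin (θ i / 2) := by
    rw [← cos_sub, sub_half]
  linear_combination (sin (θ i))⁻¹ * sin (θ i / 2) * (-sin_sq_add_cos_sq (θ i)) +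
    sin (θ i / 2) * hsin - hcos

theorem left_grassmannMidpoint (h : IsPrincipalPair Y₁ Y₂ θ) :
    IsPrincipalPair Y₁ (grassmannMidpoint Y₁ Y₂ θ) fun i => θ i / 2 where
  left_orthonormal := h.left_orthonormal
  right_orthonormal := by
    conv_lhs => enter [1, 1]; rw [grassmannMidpoint_eq]
    rw [transpose_add, Matrix.transpose_mul, Matrix.transpose_mul, Matrix.add_mul,
      Matrix.mul_assoc, Matrix.mul_assoc, h.left_transpose_mul_grassmannMidpoint,
      h.right_transpose_mul_grassmannMidpoint, diagonal_transpose, diagonal_transpose,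
      diagonal_mul_diagonal, diagonal_mul_diagonal, diagonal_add, ← diagonal_one]
    congr 1 with i
    rcases eq_or_ne (θ i) 0 with h0 | h0
    · simp [h0]
    · have hsin : sin (θ i) ≠ 0 := (sin_pos_of_pos_of_lt_pi ((h.angle_mem i).1.lt_of_ne' h0)
        (by linarith [(h.angle_mem i).2, pi_pos])).ne'
      have hsin2 : sin (θ i) = 2 * sin (θ i / 2) * cos (θ i / 2) := by
        rw [← sin_two_mul, mul_div_cancel₀ _ two_ne_zero]
      have hcos2 : cos (θ i) = 2 * cos (θ i / 2) ^ 2 - 1 := by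
        rw [← cos_two_mul, mul_div_cancel₀ _ two_ne_zero]
      have hhalf : 2 * ((sin (θ i))⁻¹ * sin (θ i / 2) * cos (θ i / 2)) = 1 := by
        linear_combination inv_mul_cancel₀ hsin - (sin (θ i))⁻¹ * hsin2
      linear_combination (1 - cos (θ i)) / 2 * hhalf - hcos2 / 2
  transpose_mul := h.left_transpose_mul_grassmannMidpoint
  angle_mem i := ⟨by linarith [(h.angle_mem i).1],
    by linarith [(h.angle_mem i).2, (h.angle_mem i).1]⟩

theorem l2_opNorm_grassmannMidpoint_sub_le (h : IsPrincipalPair Y₁ Y₂ θ) :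
    ‖grassmannMidpoint Y₁ Y₂ θ - Y₁‖ ≤ ‖Y₂ - Y₁‖ := by
  rw [← one_mul ‖Y₂ - Y₁‖]
  refine l2_opNorm_le_mul_of_transpose_mul_self_eq_diagonal
    h.left_grassmannMidpoint.transpose_sub_mul_sub h.transpose_sub_mul_sub zero_le_one fun i => ?_
  obtain ⟨h0, hlt⟩ := h.angle_mem i
  have hcos : cos (θ i) ≤ cos (θ i / 2) :=
    cos_le_cos_of_nonneg_of_le_pi (by linarith) (by linarith [pi_pos]) (by linarith)
  rw [one_pow, one_mul, abs_of_nonneg (by linarith [cos_le_one (θ i / 2)])]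
  exact (by linarith : _ ≤ _).trans (le_abs_self _)

end IsPrincipalPair

end PrincipalAngles

section RankPreservingMean

open scoped Matrix.Norms.L2Operator

variable {p n : ℕ} {A B M : Matrix (Fin n) (Fin n) ℝ} {U Y Y₁ Y₂ : Matrix (Fin n) (Fin p) ℝ}
  {θ : Fin p → ℝ}

theorem isRankPreservingMean_iff : IsRankPreservingMean p A B M ↔ A ∈ SPlus p n ∧ B ∈ SPlus p n ∧
    ∃ (Y₁ Y₂ : Matrix (Fin n) (Fin p) ℝ) (θ : Fin p → ℝ),
      IsOrthonormalBasisOfSpan Y₁ A ∧ IsOrthonormalBasisOfSpan Y₂ B ∧ IsPrincipalPair Y₁ Y₂ θ ∧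
      M = grassmannMidpoint Y₁ Y₂ θ * geomMean (Y₁ᵀ * A * Y₁) (Y₂ᵀ * B * Y₂) *
        (grassmannMidpoint Y₁ Y₂ θ)ᵀ := by
  refine and_congr_right fun _ => and_congr_right fun _ => ⟨?_, ?_⟩
  · rintro ⟨U₁, U₂, O₁, O₂, θ, hU₁, hU₂, hO₁, hO₂, hθ, hsvd, hM⟩
    have hY₁ := hU₁.mul_orthogonal hO₁
    have hY₂ := hU₂.mul_orthogonal hO₂
    refine ⟨U₁ * O₁, U₂ * O₂, θ, hY₁, hY₂, ⟨hY₁.1, hY₂.1, ?_, hθ⟩, hM⟩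
    rw [mem_orthogonalGroup_iff'] at hO₁ hO₂
    calc (U₁ * O₁)ᵀ * (U₂ * O₂) = O₁ᵀ * (U₁ᵀ * U₂) * O₂ := by
          simp only [transpose_mul, Matrix.mul_assoc]
      _ = O₁ᵀ * O₁ * diagonal (fun i => Real.cos (θ i)) * (O₂ᵀ * O₂) := by
          rw [hsvd]; simp only [Matrix.mul_assoc]
      _ = _ := by rw [hO₁, hO₂, Matrix.one_mul, Matrix.mul_one]
  · rintro ⟨Y₁, Y₂, θ, hY₁, hY₂, h, hM⟩
    refine ⟨Y₁, Y₂, 1, 1, θ, hY₁, hY₂, one_mem _, one_mem _, h.angle_mem, ?_, ?_⟩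
    · rw [h.transpose_mul, transpose_one, Matrix.one_mul, Matrix.mul_one]
    · rwa [Matrix.mul_one, Matrix.mul_one]

theorem l2_opNorm_inv_compression_le (hU : IsOrthonormalBasisOfSpan U A)
    (hY : IsOrthonormalBasisOfSpan Y A) (hA : A.PosSemidef) :
    ‖(Yᵀ * A * Y)⁻¹‖ ≤ ‖(Uᵀ * A * U)⁻¹‖ := by
  obtain ⟨O, hO, rfl⟩ := hU.exists_eq_mul hY
  have hOO := (mem_orthogonalGroup_iff _ _).1 hO
  have hOO' := (mem_orthogonalGroup_iff' _ _).1 hO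
  have hdet := (hU.posDef_compression hA).det_pos.ne'.isUnit
  have hinv : ((U * O)ᵀ * A * (U * O))⁻¹ = Oᵀ * (Uᵀ * A * U)⁻¹ * O := by
    refine inv_eq_right_inv ?_
    calc (U * O)ᵀ * A * (U * O) * (Oᵀ * (Uᵀ * A * U)⁻¹ * O)
        = Oᵀ * ((Uᵀ * A * U) * (O * Oᵀ) * (Uᵀ * A * U)⁻¹) * O := by
          simp only [transpose_mul, Matrix.mul_assoc]
      _ = 1 := by rw [hOO, Matrix.mul_one, mul_nonsing_inv _ hdet, Matrix.mul_one, hOO']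
  rw [hinv]
  exact l2_opNorm_mul_mul_le
    ((l2_opNorm_transpose O).trans_le (l2_opNorm_le_one_of_transpose_mul_self hOO'))
    (l2_opNorm_le_one_of_transpose_mul_self hOO') _

theorem l2_opNorm_midpoint_conj_geomMean_sub_le (hA : A.PosSemidef) (hB : B.PosSemidef)
    (hY₁ : IsOrthonormalBasisOfSpan Y₁ A) (hY₂ : IsOrthonormalBasisOfSpan Y₂ B)
    (h : IsPrincipalPair Y₁ Y₂ θ) :
    ‖grassmannMidpoint Y₁ Y₂ θ * geomMean (Y₁ᵀ * A * Y₁) (Y₂ᵀ * B * Y₂) *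
        (grassmannMidpoint Y₁ Y₂ θ)ᵀ - A‖ ≤
      ‖A‖ * ‖(Y₁ᵀ * A * Y₁)⁻¹‖ * (4 * (‖A‖ * ‖(Y₁ᵀ * A * Y₁)⁻¹‖) + 5) * ‖B - A‖ := by
  set W := grassmannMidpoint Y₁ Y₂ θ
  set P := Y₁ᵀ * A * Y₁ with hP
  set Q := Y₂ᵀ * B * Y₂
  have hn₁ : ‖Y₁‖ ≤ 1 := l2_opNorm_le_one_of_transpose_mul_self hY₁.1
  have hn₂ : ‖Y₂‖ ≤ 1 := l2_opNorm_le_one_of_transpose_mul_self hY₂.1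
  have hnW : ‖W‖ ≤ 1 :=
    l2_opNorm_le_one_of_transpose_mul_self h.left_grassmannMidpoint.right_orthonormal
  rw [← l2_opNorm_transpose] at hn₁ hn₂
  have hPA : ‖P‖ ≤ ‖A‖ := l2_opNorm_mul_mul_le hn₁ (l2_opNorm_transpose Y₁ ▸ hn₁) A
  have hbases : ‖Y₂ - Y₁‖ ≤ 2 * (‖P⁻¹‖ * ‖B - A‖) :=
    h.l2_opNorm_sub_le.trans (by gcongr; exact h.l2_opNorm_one_sub_proj_mul_le hY₁ hY₂ hA)
  have hcompressions : ‖Q - P‖ ≤ (1 + 4 * (‖A‖ * ‖P⁻¹‖)) * ‖B - A‖ :=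
    calc ‖Q - P‖ ≤ ‖B - A‖ + 2 * ‖A‖ * ‖Y₂ - Y₁‖ := by
          have := l2_opNorm_conj_sub_conj_le hn₂ hn₁ A B
          rwa [transpose_transpose, transpose_transpose, ← transpose_sub,
            l2_opNorm_transpose] at this
      _ ≤ ‖B - A‖ + 2 * ‖A‖ * (2 * (‖P⁻¹‖ * ‖B - A‖)) := by gcongr
      _ = (1 + 4 * (‖A‖ * ‖P⁻¹‖)) * ‖B - A‖ := by ring
  have hmeans : ‖geomMean P Q - P‖ ≤
      ‖A‖ * ‖P⁻¹‖ * ((1 + 4 * (‖A‖ * ‖P⁻¹‖)) * ‖B - A‖) :=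
    (l2_opNorm_geomMean_sub_le (hY₁.posDef_compression hA) (posSemidef_compression hB Y₂)).trans
      (by gcongr)
  calc ‖W * geomMean P Q * Wᵀ - A‖ = ‖W * geomMean P Q * Wᵀ - Y₁ * P * Y₁ᵀ‖ := by
        rw [hP, hY₁.mul_compression_mul hA.isHermitian]
    _ ≤ ‖geomMean P Q - P‖ + 2 * ‖P‖ * ‖W - Y₁‖ :=
        l2_opNorm_conj_sub_conj_le hnW (l2_opNorm_transpose Y₁ ▸ hn₁) _ _
    _ ≤ ‖A‖ * ‖P⁻¹‖ * ((1 + 4 * (‖A‖ * ‖P⁻¹‖)) * ‖B - A‖) +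
          2 * ‖A‖ * (2 * (‖P⁻¹‖ * ‖B - A‖)) := by
        gcongr
        exact h.l2_opNorm_grassmannMidpoint_sub_le.trans hbases
    _ = ‖A‖ * ‖P⁻¹‖ * (4 * (‖A‖ * ‖P⁻¹‖) + 5) * ‖B - A‖ := by ring

theorem IsRankPreservingMean.l2_opNorm_sub_le (hM : IsRankPreservingMean p A B M)
    (hU : IsOrthonormalBasisOfSpan U A) :
    ‖M - A‖ ≤ ‖A‖ * ‖(Uᵀ * A * U)⁻¹‖ * (4 * (‖A‖ * ‖(Uᵀ * A * U)⁻¹‖) + 5) * ‖B - A‖ := by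
  obtain ⟨hA, hB, Y₁, Y₂, θ, hY₁, hY₂, h, rfl⟩ := isRankPreservingMean_iff.1 hM
  have hinv := l2_opNorm_inv_compression_le hU hY₁ hA.1
  exact (l2_opNorm_midpoint_conj_geomMean_sub_le hA.1 hB.1 hY₁ hY₂ h).trans (by gcongr)

theorem exists_svd_of_det_ne_zero {ι : Type*} [Fintype ι] [DecidableEq ι] {N : Matrix ι ι ℝ}
    (hN : N.det ≠ 0) : ∃ O₁ ∈ orthogonalGroup ι ℝ, ∃ O₂ ∈ orthogonalGroup ι ℝ, ∃ σ : ι → ℝ,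
      (∀ i, 0 < σ i) ∧ O₁ᵀ * N * O₂ = diagonal σ := by
  have hpd : (Nᵀ * N).PosDef := by
    rw [← conjTranspose_eq_transpose_of_trivial,
      (posSemidef_conjTranspose_mul_self N).posDef_iff_det_ne_zero, det_mul, det_conjTranspose]
    exact mul_ne_zero (star_ne_zero.2 hN) hN
  set V : Matrix ι ι ℝ := hpd.isHermitian.eigenvectorUnitary.1
  set l := hpd.isHermitian.eigenvalues
  have hV : Vᵀ * V = 1 :=
    (mem_orthogonalGroup_iff' _ _).1 hpd.isHermitian.eigenvectorUnitary.2
  have hdiag : Vᵀ * (Nᵀ * N) * V = diagonal l :=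
    hpd.isHermitian.conjStarAlgAut_star_eigenvectorUnitary
  have hs : ∀ i, 0 < √(l i) := fun i => Real.sqrt_pos.2 (hpd.eigenvalues_pos i)
  refine ⟨N * V * diagonal fun i => (√(l i))⁻¹, (mem_orthogonalGroup_iff' _ _).2 ?_, V,
    (mem_orthogonalGroup_iff' _ _).2 hV, fun i => √(l i), hs, ?_⟩
  · calc (N * V * diagonal fun i => (√(l i))⁻¹)ᵀ * (N * V * diagonal fun i => (√(l i))⁻¹)
        = (diagonal fun i => (√(l i))⁻¹) * (Vᵀ * (Nᵀ * N) * V) * diagonal fun i => (√(l i))⁻¹ := by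
          simp only [transpose_mul, diagonal_transpose, Matrix.mul_assoc]
      _ = 1 := by
          rw [hdiag, diagonal_mul_diagonal, diagonal_mul_diagonal, ← diagonal_one]
          congr 1 with i
          rw [mul_assoc, ← div_eq_mul_inv, Real.div_sqrt, inv_mul_cancel₀ (hs i).ne']
  · calc (N * V * diagonal fun i => (√(l i))⁻¹)ᵀ * N * V
        = (diagonal fun i => (√(l i))⁻¹) * (Vᵀ * (Nᵀ * N) * V) := by
          simp only [transpose_mul, diagonal_transpose, Matrix.mul_assoc]
      _ = diagonal fun i => √(l i) := by
          rw [hdiag, diagonal_mul_diagonal]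
          congr 1 with i
          rw [mul_comm, ← div_eq_mul_inv, Real.div_sqrt]

theorem exists_isPrincipalPair {U₁ U₂ : Matrix (Fin n) (Fin p) ℝ}
    (hU₁ : IsOrthonormalBasisOfSpan U₁ A) (hU₂ : IsOrthonormalBasisOfSpan U₂ B)
    (hdet : (U₁ᵀ * U₂).det ≠ 0) : ∃ (Y₁ Y₂ : Matrix (Fin n) (Fin p) ℝ) (θ : Fin p → ℝ),
      IsOrthonormalBasisOfSpan Y₁ A ∧ IsOrthonormalBasisOfSpan Y₂ B ∧ IsPrincipalPair Y₁ Y₂ θ := by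
  obtain ⟨O₁, hO₁, O₂, hO₂, σ, hσ, hsvd⟩ := exists_svd_of_det_ne_zero hdet
  have hY₁ := hU₁.mul_orthogonal hO₁
  have hY₂ := hU₂.mul_orthogonal hO₂
  have hdiag : (U₁ * O₁)ᵀ * (U₂ * O₂) = diagonal σ := by
    rw [← hsvd, transpose_mul]; simp only [Matrix.mul_assoc]
  have hσ1 : ∀ i, σ i ≤ 1 := fun i =>
    calc σ i ≤ ‖σ‖ := (le_abs_self _).trans (norm_le_pi_norm σ i)
      _ = ‖(U₁ * O₁)ᵀ * (U₂ * O₂)‖ := by rw [hdiag, l2_opNorm_diagonal]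
      _ ≤ ‖(U₁ * O₁)ᵀ‖ * ‖U₂ * O₂‖ := l2_opNorm_mul _ _
      _ ≤ 1 := by
        rw [l2_opNorm_transpose]
        exact mul_le_one₀ (l2_opNorm_le_one_of_transpose_mul_self hY₁.1) (norm_nonneg _)
          (l2_opNorm_le_one_of_transpose_mul_self hY₂.1)
  refine ⟨U₁ * O₁, U₂ * O₂, fun i => Real.arccos (σ i), hY₁, hY₂, hY₁.1, hY₂.1, ?_,
    fun i => ⟨Real.arccos_nonneg _, Real.arccos_lt_pi_div_two.2 (hσ i)⟩⟩
  simp only [hdiag, Real.cos_arccos (neg_one_lt_zero.le.trans (hσ _).le) (hσ1 _)]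

theorem exists_isRankPreservingMean {U : Matrix (Fin n) (Fin p) ℝ} (hA : A ∈ SPlus p n)
    (hB : B ∈ SPlus p n) (hU : IsOrthonormalBasisOfSpan U A) (hdet : (Uᵀ * B * U).det ≠ 0) :
    ∃ M, IsRankPreservingMean p A B M := by
  obtain ⟨U', hU'⟩ := exists_isOrthonormalBasisOfSpan hB.2
  have hfactor : Uᵀ * B * U = Uᵀ * U' * (U'ᵀ * B * U) := by
    conv_lhs => rw [← hU'.mul_transpose_mul]
    simp only [Matrix.mul_assoc]
  rw [hfactor, det_mul] at hdet
  obtain ⟨Y₁, Y₂, θ, h⟩ := exists_isPrincipalPair hU hU' (left_ne_zero_of_mul hdet)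
  exact ⟨_, isRankPreservingMean_iff.2 ⟨hA, hB, Y₁, Y₂, θ, h.1, h.2.1, h.2.2, rfl⟩⟩

theorem eventually_isRankPreservingMean_mem (hA : A ∈ SPlus p n)
    {V : Set (Matrix (Fin n) (Fin n) ℝ)} (hV : V ∈ 𝓝 A) :
    ∀ᶠ B in 𝓝[SPlus p n] A, (∃ M, IsRankPreservingMean p A B M) ∧
      ∀ M, IsRankPreservingMean p A B M → M ∈ V := by
  obtain ⟨U, hU⟩ := exists_isOrthonormalBasisOfSpan hA.2
  obtain ⟨ε, hε, hball⟩ := Metric.mem_nhds_iff.1 hV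
  set κ := ‖A‖ * ‖(Uᵀ * A * U)⁻¹‖
  have hdet : ∀ᶠ B in 𝓝 A, (Uᵀ * B * U).det ≠ 0 :=
    ContinuousAt.eventually_ne (by fun_prop) (hU.posDef_compression hA.1).det_pos.ne'
  have hbound : ∀ᶠ B in 𝓝 A, κ * (4 * κ + 5) * ‖B - A‖ < ε := by
    have hcont : Continuous fun B : Matrix (Fin n) (Fin n) ℝ => κ * (4 * κ + 5) * ‖B - A‖ := by
      fun_prop
    exact hcont.continuousAt.eventually_lt_const (by simpa using hε)
  filter_upwards [self_mem_nhdsWithin, nhdsWithin_le_nhds hdet, nhdsWithin_le_nhds hbound]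
    with B hB hdet hbound
  exact ⟨exists_isRankPreservingMean hA hB hU hdet, fun M hM =>
    hball (mem_ball_iff_norm.2 ((hM.l2_opNorm_sub_le hU).trans_lt hbound))⟩

end RankPreservingMean

section Rotations

variable {p n : ℕ} {A R : Matrix (Fin n) (Fin n) ℝ}

theorem conj_mem_SPlus (hA : A ∈ SPlus p n) (hR : R ∈ orthogonalGroup (Fin n) ℝ) :
    R * A * Rᵀ ∈ SPlus p n := by
  have hRR := (mem_orthogonalGroup_iff _ _).1 hR
  refine ⟨by simpa only [conjTranspose_eq_transpose_of_trivial] using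
    hA.1.mul_mul_conjTranspose_same R, ?_⟩
  rw [rank_mul_eq_left_of_isUnit_det _ _ (isUnit_det_of_left_inverse hRR),
    rank_mul_eq_right_of_isUnit_det _ _ (isUnit_det_of_right_inverse hRR), hA.2]

theorem exists_rotationMagnitude_lt_imp_of_eventually {q : Matrix (Fin n) (Fin n) ℝ → Prop}
    (hA : A ∈ SPlus p n) (hq : ∀ᶠ B in 𝓝[SPlus p n] A, q B) :
    ∃ δ : ℝ≥0∞, 0 < δ ∧
      ∀ R ∈ specialOrthogonalGroup (Fin n) ℝ, rotationMagnitude R < δ → q (R * A * Rᵀ) := by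
  have hconj : Tendsto (fun R : Matrix (Fin n) (Fin n) ℝ => R * A * Rᵀ) (𝓝 1) (𝓝 A) :=
    Continuous.tendsto' (by fun_prop) _ _ (by simp)
  obtain ⟨δ, hδ, hlt⟩ :=
    exists_forall_rotationMagnitude_lt_mem (hconj.eventually (eventually_nhdsWithin_iff.1 hq))
  exact ⟨δ, hδ, fun R hR h => hlt R h (conj_mem_SPlus hA (mem_specialOrthogonalGroup_iff.1 hR).1)⟩

end Rotations

theorem proposition7_general {p n : ℕ} {A : Matrix (Fin n) (Fin n) ℝ} (hA : A ∈ SPlus p n) :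
    (∀ B : Matrix (Fin n) (Fin n) ℝ, B.PosSemidef →
        colSpan B ⊓ colSpan A = ⊥ → IsAndoMean A B 0) ∧
    (0 < p → 2 * p ≤ n → ∀ δ : ℝ≥0∞, 0 < δ →
        ∃ R ∈ specialOrthogonalGroup (Fin n) ℝ,
          0 < rotationMagnitude R ∧ rotationMagnitude R < δ ∧
            colSpan (R * A * Rᵀ) ⊓ colSpan A = ⊥) ∧
    (∀ V ∈ 𝓝 A, ∀ᶠ B in 𝓝[SPlus p n] A, (∃ M, IsRankPreservingMean p A B M) ∧
      ∀ M, IsRankPreservingMean p A B M → M ∈ V) := by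
  exact ⟨fun B hB h => isAndoMean_zero hA.1 hB (inf_comm (colSpan B) _ ▸ h),
    fun hp hpn _ hδ => exists_rotation_colSpan_inf_eq_bot (by rwa [hA.2]) (by rwa [hA.2]) hδ,
    fun _ hV => eventually_isRankPreservingMean_mem hA hV⟩

theorem proposition7 (p n : ℕ) (A : Matrix (Fin n) (Fin n) ℝ) (hA : A ∈ SPlus p n) :
    (∀ R ∈ Matrix.specialOrthogonalGroup (Fin n) ℝ,
        colSpan (R * A * Rᵀ) ⊓ colSpan A = ⊥ → IsAndoMean A (R * A * Rᵀ) 0) ∧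
    (0 < p → (p : ℝ) < (n : ℝ) / 2 → ∀ δ : ℝ≥0∞, 0 < δ →
        ∃ R ∈ Matrix.specialOrthogonalGroup (Fin n) ℝ,
          0 < rotationMagnitude R ∧ rotationMagnitude R < δ ∧
            colSpan (R * A * Rᵀ) ⊓ colSpan A = ⊥) ∧
    (∀ V ∈ 𝓝 A, ∃ δ : ℝ≥0∞, 0 < δ ∧
        ∀ R ∈ Matrix.specialOrthogonalGroup (Fin n) ℝ, rotationMagnitude R < δ →
          (∃ M, IsRankPreservingMean p A (R * A * Rᵀ) M) ∧
            ∀ M, IsRankPreservingMean p A (R * A * Rᵀ) M → M ∈ V) := by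
  obtain ⟨hzero, hrot, hmean⟩ := proposition7_general hA
  have hconj : ∀ R ∈ specialOrthogonalGroup (Fin n) ℝ, R * A * Rᵀ ∈ SPlus p n := fun R hR =>
    conj_mem_SPlus hA (mem_specialOrthogonalGroup_iff.1 hR).1
  refine ⟨fun R hR => hzero _ (hconj R hR).1, fun hp hpn => hrot hp ?_,
    fun V hV => exists_rotationMagnitude_lt_imp_of_eventually hA (hmean V hV)⟩
  exact_mod_cast (by linarith : (2 * p : ℝ) ≤ n)
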